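/- Let $b\in\{1,-1\}$, let $m\ge 1$ be an integer coprime to $10$, let $q=5^m$, and let $K$ be an algebraic closure of $\mathbb{F}_q$. Let $C$ be the smooth projective curve of genus $2$ over $\mathbb{F}_q$ with affine equation $y^2=x^5-x+b$ (it has exactly one point at infinity), let $\mathrm{Jac}(C)$ be its Jacobian, and identify $\mathrm{Jac}(C)(K)$ with the group of divisor classes of degree $0$ on $C$ over $K$. Let $\pi$ be the endomorphism of $\mathrm{Jac}(C)(K)$ induced by the $q$-power Frobenius map $(x,y)\mapsto(x^q,y^q)$ on points, so that $\mathrm{Jac}(C)(\mathbb{F}_{q^n})=\{D\in\mathrm{Jac}(C)(K):\pi^n(D)=D\}$ for $n\ge1$. The trace is the homomorphism $$\mathrm{Tr}:\mathrm{Jac}(C)(\mathbb{F}_{q^n})\to\mathrm{Jac}(C)(\mathbb{F}_q),\qquad \mathrm{Tr}(D)=\sum_{i=0}^{n-1}\pi^i(D),$$ and its kernel is the trace-zero subgroup of $\mathrm{Jac}(C)(\mathbb{F}_{q^n})$. Let $\rho\in\mathbb{F}_{5^5}\subset K$ satisfy $\rho^5-\rho+2b=0$, and let $\psi$ be the endomorphism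 of $\mathrm{Jac}(C)$ induced by the automorphism $(x,y)\mapsto(\rho-x,\,2y)$ of $C$. If $D\in\mathrm{Jac}(C)(\mathbb{F}_q)$, then $\psi(D)$ lies in $\mathrm{Jac}(C)(\mathbb{F}_{q^5})$ and $\mathrm{Tr}(\psi(D))=\sum_{i=0}^{4}\pi^i(\psi(D))=0$; that is, $\psi(D)$ lies in the trace-zero subgroup of $\mathrm{Jac}(C)(\mathbb{F}_{q^5})$. -/

import Mathlib

noncomputable section

open Polynomial WithZero

namespace QuinticCurve

/-- The polynomial `x ^ 5 - x + b` over `K`. -/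
def quintic (K : Type*) [Field K] (b : ℤ) : K[X] := X ^ 5 - X + C (b : K)

/-- The affine coordinate ring `K[x, y] / (y ^ 2 - (x ^ 5 - x + b))`; its elements are written
`u + v y` with `u = re` and `v = im` in `K[x]`. -/
abbrev CoordRing (K : Type*) [Field K] (b : ℤ) : Type _ :=
  QuadraticAlgebra K[X] (quintic K b) 0

/-- The function field of the curve. -/
abbrev FunField (K : Type*) [Field K] (b : ℤ) : Type _ := FractionRing (CoordRing K b)

section Basic

variable {K : Type*} [Field K] {b : ℤ}

lemma degree_quintic : (quintic K b).degree = 5 := by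
  unfold quintic; compute_degree!

lemma quintic_ne_zero : quintic K b ≠ 0 := by
  intro h
  have := degree_quintic (K := K) (b := b)
  simp [h] at this

lemma norm_eq (r : CoordRing K b) :
    QuadraticAlgebra.norm r = r.re ^ 2 - quintic K b * r.im ^ 2 := by
  rw [QuadraticAlgebra.norm_def]; ring

lemma degree_norm (r : CoordRing K b) :
    (QuadraticAlgebra.norm r).degree = max (r.re ^ 2).degree (quintic K b * r.im ^ 2).degree := by
  rw [norm_eq]
  by_cases hu : r.re = 0
  · simp [hu]
  by_cases hv : r.im = 0
  · simp [hv]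
  have h : (r.re ^ 2).degree ≠ (quintic K b * r.im ^ 2).degree := by
    rw [degree_mul, degree_pow, degree_pow, degree_quintic, degree_eq_natDegree hu,
      degree_eq_natDegree hv]
    intro h
    have h2 : 2 * r.re.natDegree = 5 + 2 * r.im.natDegree := by
      have : ((2 * r.re.natDegree : ℕ) : WithBot ℕ) = ((5 + 2 * r.im.natDegree : ℕ) : WithBot ℕ) := by
        push_cast; simpa using h
      exact_mod_cast this
    omega
  rw [sub_eq_add_neg]
  rw [← degree_neg (quintic K b * r.im ^ 2)] at h ⊢
  rcases lt_or_gt_of_ne h with h | h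
  · rw [degree_add_eq_right_of_degree_lt h, max_eq_right h.le]
  · rw [degree_add_eq_left_of_degree_lt h, max_eq_left h.le]

lemma norm_eq_zero {r : CoordRing K b} : QuadraticAlgebra.norm r = 0 ↔ r = 0 := by
  constructor
  · intro h
    have h1 := degree_norm r
    rw [h, degree_zero, eq_comm, max_eq_bot, degree_eq_bot, degree_eq_bot] at h1
    have h2 := h1.2
    rw [mul_eq_zero, or_iff_right quintic_ne_zero] at h2
    exact QuadraticAlgebra.ext (pow_eq_zero_iff two_ne_zero |>.1 h1.1)
      (pow_eq_zero_iff two_ne_zero |>.1 h2)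
  · rintro rfl; simp

instance : NoZeroDivisors (CoordRing K b) where
  eq_zero_or_eq_zero_of_mul_eq_zero {x y} h := by
    rw [← norm_eq_zero, map_mul, mul_eq_zero, norm_eq_zero, norm_eq_zero] at h
    exact h

instance : IsDomain (CoordRing K b) := NoZeroDivisors.to_isDomain _

instance : IsNoetherianRing (CoordRing K b) := IsNoetherianRing.of_finite K[X] _

instance : Ring.DimensionLEOne (CoordRing K b) := Ring.DimensionLEOne.of_isIntegral K[X] _

lemma dvd_of_sq_dvd {n v f : K[X]} (hf : Squarefree f) (h : n ^ 2 ∣ f * v ^ 2) : n ∣ v := by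
  by_cases hn : n = 0
  · subst hn
    have : f * v ^ 2 = 0 := by simpa using h
    rcases mul_eq_zero.1 this with h0 | h0
    · exact absurd h0 hf.ne_zero
    · simp [pow_eq_zero_iff two_ne_zero |>.1 h0]
  let : GCDMonoid K[X] := UniqueFactorizationMonoid.toGCDMonoid _
  obtain ⟨n', v', h1, h2, hu⟩ := extract_gcd n v
  set d := gcd n v with hd
  have hd0 : d ≠ 0 := by
    intro h0; rw [h0, zero_mul] at h1; exact hn h1
  have hc : IsCoprime (n' ^ 2) (v' ^ 2) := ((gcd_isUnit_iff _ _).1 hu).pow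
  have h3 : n' ^ 2 ∣ f * v' ^ 2 := by
    rw [h1, h2] at h
    have : d ^ 2 * n' ^ 2 ∣ d ^ 2 * (f * v' ^ 2) := by
      convert h using 1 <;> ring
    exact (mul_dvd_mul_iff_left (pow_ne_zero 2 hd0)).1 this
  have h4 : n' * n' ∣ f := by
    rw [← sq]; exact hc.dvd_of_dvd_mul_right h3
  rw [h1, h2]
  exact mul_dvd_mul_left d (hf n' h4).dvd

lemma dvd_of_isIntegral {n p : K[X]} (hn : n ≠ 0)
    (h : IsIntegral K[X] (algebraMap K[X] (FunField K b) p /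
      algebraMap K[X] (FunField K b) n)) : n ∣ p := by
  let := FractionRing.liftAlgebra K[X] (FunField K b)
  rw [IsScalarTower.algebraMap_apply K[X] (FractionRing K[X]) (FunField K b),
    IsScalarTower.algebraMap_apply K[X] (FractionRing K[X]) (FunField K b) n,
    ← map_div₀, isIntegral_algebraMap_iff (FaithfulSMul.algebraMap_injective _ _),
    IsIntegrallyClosed.isIntegral_iff] at h
  obtain ⟨y, hy⟩ := h
  refine ⟨y, ?_⟩
  apply FaithfulSMul.algebraMap_injective K[X] (FractionRing K[X])
  have : algebraMap K[X] (FractionRing K[X]) n ≠ 0 := by simpa using hn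
  rw [map_mul, hy]; field_simp

/-- The hyperelliptic involution `u + v y ↦ u - v y` on the coordinate ring. -/
def conj : CoordRing K b →ₐ[K[X]] CoordRing K b where
  __ := (starRingEnd (CoordRing K b))
  commutes' p := by
    change star (algebraMap K[X] (CoordRing K b) p) = _
    ext <;> simp

lemma conj_apply (r : CoordRing K b) : conj r = ⟨r.re, -r.im⟩ := by
  change star r = _
  ext <;> simp

lemma exists_conj_funField : ∃ σ : FunField K b →ₐ[K[X]] FunField K b,
    ∀ r : CoordRing K b, σ (algebraMap _ (FunField K b) r) =
      algebraMap _ (FunField K b) (conj r) := by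
  have hg : Function.Injective
      ((IsScalarTower.toAlgHom K[X] (CoordRing K b) (FunField K b)).comp conj) := by
    intro r s h
    have h1 : conj r = conj s := IsFractionRing.injective (CoordRing K b) (FunField K b) h
    rw [conj_apply, conj_apply, QuadraticAlgebra.mk.injEq, neg_inj] at h1
    exact QuadraticAlgebra.ext h1.1 h1.2
  exact ⟨IsFractionRing.liftAlgHom hg, fun r => IsFractionRing.lift_algebraMap hg r⟩

end Basic

section Dedekind

variable {K : Type*} [Field K] [CharP K 5] {b : ℤ}

lemma squarefree_quintic : Squarefree (quintic K b) := by
  apply Separable.squarefree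
  have h5 : ((5 : ℕ) : K) = 0 := CharP.cast_eq_zero K 5
  refine ⟨0, -1, ?_⟩
  have : derivative (quintic K b) = -1 := by
    unfold quintic
    simp only [derivative_add, derivative_sub, derivative_X_pow, derivative_X, derivative_C, h5]
    simp
  rw [this]; simp

lemma two_ne_zero_of_char : (2 : K) ≠ 0 := by
  have : ((2 : ℕ) : K) ≠ 0 := by
    rw [Ne, CharP.cast_eq_zero_iff K 5]; decide
  exact_mod_cast this

lemma exists_of_isIntegral (t : CoordRing K b) {n : K[X]} (hn0 : n ≠ 0)
    (hz : IsIntegral K[X] (algebraMap _ (FunField K b) t / algebraMap K[X] (FunField K b) n)) :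
    ∃ q : CoordRing K b, t = q * algebraMap K[X] (CoordRing K b) n := by
  obtain ⟨σ, hσ⟩ := exists_conj_funField (K := K) (b := b)
  have hσz := hz.map σ
  rw [map_div₀, hσ, AlgHom.commutes] at hσz
  have hadd := hz.add hσz
  have hsub := (hz.sub hσz).pow 2
  have e1 : t + conj t = algebraMap K[X] _ (2 * t.re) := by
    rw [conj_apply, QuadraticAlgebra.algebraMap_eq]
    exact QuadraticAlgebra.ext (by simp; ring) (by simp)
  have e2 : (t - conj t) ^ 2 = algebraMap K[X] _ (quintic K b * (2 * t.im) ^ 2) := by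
    rw [conj_apply, sq, QuadraticAlgebra.algebraMap_eq]
    exact QuadraticAlgebra.ext (by simp; ring) (by simp)
  rw [← add_div, ← map_add, e1, ← IsScalarTower.algebraMap_apply] at hadd
  rw [← sub_div, ← map_sub, div_pow, ← map_pow, ← map_pow, e2,
    ← IsScalarTower.algebraMap_apply] at hsub
  have d1 := dvd_of_isIntegral hn0 hadd
  have d2 := dvd_of_sq_dvd squarefree_quintic (dvd_of_isIntegral (pow_ne_zero 2 hn0) hsub)
  have h2u : IsUnit (2 : K[X]) := by
    rw [← C_ofNat]; exact isUnit_C.2 (isUnit_iff_ne_zero.2 two_ne_zero_of_char)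
  obtain ⟨p, hp⟩ := h2u.dvd_mul_left.1 d1
  obtain ⟨v, hv⟩ := h2u.dvd_mul_left.1 d2
  refine ⟨⟨p, v⟩, ?_⟩
  rw [QuadraticAlgebra.algebraMap_eq]
  exact QuadraticAlgebra.ext (by simp [hp, mul_comm]) (by simp [hv, mul_comm])

lemma isIntegrallyClosed : IsIntegrallyClosed (CoordRing K b) := by
  rw [isIntegrallyClosed_iff (FunField K b)]
  intro z hz
  have hz' : IsIntegral K[X] z := isIntegral_trans z hz
  obtain ⟨r, s, hs, rfl⟩ := IsFractionRing.div_surjective (A := CoordRing K b) z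
  have hs0 : s ≠ 0 := nonZeroDivisors.ne_zero hs
  have hn0 : QuadraticAlgebra.norm s ≠ 0 := norm_eq_zero.not.2 hs0
  have hns : algebraMap K[X] (CoordRing K b) (QuadraticAlgebra.norm s) = s * conj s :=
    QuadraticAlgebra.algebraMap_norm_eq_mul_star s
  have hconj0 : conj s ≠ 0 := by
    intro h
    rw [h, mul_zero, QuadraticAlgebra.algebraMap_eq] at hns
    exact hn0 (congrArg QuadraticAlgebra.re hns)
  have h1 : algebraMap _ (FunField K b) s ≠ 0 :=
    (map_ne_zero_iff _ (IsFractionRing.injective _ _)).2 hs0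
  have h2 : algebraMap _ (FunField K b) (conj s) ≠ 0 :=
    (map_ne_zero_iff _ (IsFractionRing.injective _ _)).2 hconj0
  have hz2 : algebraMap _ (FunField K b) r / algebraMap _ (FunField K b) s =
      algebraMap _ (FunField K b) (r * conj s) /
        algebraMap K[X] (FunField K b) (QuadraticAlgebra.norm s) := by
    rw [IsScalarTower.algebraMap_apply K[X] (CoordRing K b) (FunField K b), hns, map_mul, map_mul,
      mul_div_mul_right _ _ h2]
  rw [hz2] at hz'
  obtain ⟨q, hq⟩ := exists_of_isIntegral _ hn0 hz'
  refine ⟨q, ?_⟩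
  rw [eq_div_iff h1, ← map_mul]
  congr 1
  rw [hns, ← mul_assoc] at hq
  exact (mul_right_cancel₀ hconj0 hq).symm

instance : IsDedekindDomain (CoordRing K b) where
  __ := (inferInstance : IsDomain (CoordRing K b))
  __ := (inferInstance : IsNoetherianRing (CoordRing K b))
  __ := (inferInstance : Ring.DimensionLEOne (CoordRing K b))
  __ := (isIntegrallyClosed : IsIntegrallyClosed (CoordRing K b))

end Dedekind

/-- The points of the smooth projective curve with affine model `y ^ 2 = x ^ 5 - x + b`:
the affine solutions over `K`, and a single point at infinity. -/
inductive Point (K : Type*) [Field K] (b : ℤ) : Type _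
  | infinity : Point K b
  | affine (x y : K) (h : y ^ 2 = x ^ 5 - x + (b : K)) : Point K b

section Valuations

variable {K : Type*} [Field K] {b : ℤ}

/-- Evaluation of a regular function at an affine point. -/
def evalAt (x y : K) (h : y ^ 2 = x ^ 5 - x + (b : K)) : CoordRing K b →+* K where
  toFun r := r.re.eval x + r.im.eval x * y
  map_zero' := by simp
  map_one' := by simp [QuadraticAlgebra.re_one, QuadraticAlgebra.im_one]
  map_add' r s := by simp; ring
  map_mul' r s := by
    have hq : (quintic K b).eval x = y ^ 2 := by rw [h]; simp [quintic]
    simp [hq]; ring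

lemma evalAt_apply (x y : K) (h : y ^ 2 = x ^ 5 - x + (b : K)) (r : CoordRing K b) :
    evalAt x y h r = r.re.eval x + r.im.eval x * y := rfl

/-- The maximal ideal of the regular functions that vanish at an affine point. -/
def pointIdeal (x y : K) (h : y ^ 2 = x ^ 5 - x + (b : K)) :
    IsDedekindDomain.HeightOneSpectrum (CoordRing K b) where
  asIdeal := RingHom.ker (evalAt x y h)
  isPrime := RingHom.ker_isPrime _
  ne_bot := by
    intro h0
    have h1 : (⟨X - C x, 0⟩ : CoordRing K b) ∈ RingHom.ker (evalAt x y h) := by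
      rw [RingHom.mem_ker, evalAt_apply]; simp
    rw [h0, Ideal.mem_bot] at h1
    exact X_sub_C_ne_zero x (congrArg QuadraticAlgebra.re h1)

open scoped Classical in
/-- The valuation at the point at infinity on the regular functions: the pole order of
`r = u + v y` there is the degree of its norm `u ^ 2 - (x ^ 5 - x + b) v ^ 2` to `K[x]`,
that is, `max (2 deg u) (2 deg v + 5)`. -/
def inftyIntValuation (K : Type*) [Field K] (b : ℤ) : Valuation (CoordRing K b) ℤᵐ⁰ where
  toFun r := if r = 0 then 0 else exp ((QuadraticAlgebra.norm r).natDegree : ℤ)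
  map_zero' := by simp
  map_one' := by simp
  map_mul' r s := by
    by_cases hr : r = 0
    · simp [hr]
    by_cases hs : s = 0
    · simp [hs]
    rw [if_neg (mul_ne_zero hr hs), if_neg hr, if_neg hs, map_mul,
      natDegree_mul (norm_eq_zero.not.2 hr) (norm_eq_zero.not.2 hs), ← exp_add]
    push_cast; rfl
  map_add_le_max' r s := by
    by_cases hrs : r + s = 0
    · simp [hrs]
    by_cases hr : r = 0
    · simp [hr]
    by_cases hs : s = 0
    · simp [hs]
    rw [if_neg hrs, if_neg hr, if_neg hs]
    have key (u v : K[X]) : ((u + v) ^ 2).degree ≤ max (u ^ 2).degree (v ^ 2).degree := by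
      simp only [degree_pow]
      rcases le_max_iff.1 (degree_add_le u v) with h | h
      · exact le_max_of_le_left (nsmul_le_nsmul_right h 2)
      · exact le_max_of_le_right (nsmul_le_nsmul_right h 2)
    have h : (QuadraticAlgebra.norm (r + s)).degree ≤
        max (QuadraticAlgebra.norm r).degree (QuadraticAlgebra.norm s).degree := by
      simp only [degree_norm, QuadraticAlgebra.re_add, QuadraticAlgebra.im_add]
      refine max_le ((key _ _).trans (max_le_max (le_max_left _ _) (le_max_left _ _))) ?_
      rw [degree_mul]
      rcases le_max_iff.1 (key r.im s.im) with h | h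
      · refine le_max_of_le_left (le_max_of_le_right ?_)
        rw [degree_mul]; gcongr
      · refine le_max_of_le_right (le_max_of_le_right ?_)
        rw [degree_mul]; gcongr
    rcases le_max_iff.1 h with h | h
    · exact le_max_of_le_left (exp_le_exp.2 (by exact_mod_cast natDegree_le_natDegree h))
    · exact le_max_of_le_right (exp_le_exp.2 (by exact_mod_cast natDegree_le_natDegree h))

lemma inftyIntValuation_of_ne_zero {r : CoordRing K b} (hr : r ≠ 0) :
    inftyIntValuation K b r = exp ((QuadraticAlgebra.norm r).natDegree : ℤ) := by
  classical
  exact if_neg hr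

lemma nonZeroDivisors_le_primeCompl :
    nonZeroDivisors (CoordRing K b) ≤ (inftyIntValuation K b).supp.primeCompl := by
  intro r hr h
  have h0 := nonZeroDivisors.ne_zero hr
  rw [SetLike.mem_coe, Valuation.mem_supp_iff, inftyIntValuation_of_ne_zero h0] at h
  exact exp_ne_zero h

/-- The valuation at the point at infinity on the function field. -/
def inftyValuation (K : Type*) [Field K] (b : ℤ) : Valuation (FunField K b) ℤᵐ⁰ :=
  (inftyIntValuation K b).extendToLocalization nonZeroDivisors_le_primeCompl (FunField K b)

lemma inftyValuation_algebraMap (r : CoordRing K b) :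
    inftyValuation K b (algebraMap _ (FunField K b) r) = inftyIntValuation K b r :=
  Valuation.extendToLocalization_apply_map_apply _ _ _ _

variable [CharP K 5]

/-- The normalized discrete valuation of the function field at a point of the curve. -/
def Point.valuation : Point K b → Valuation (FunField K b) ℤᵐ⁰
  | .infinity => inftyValuation K b
  | .affine x y h => (pointIdeal x y h).valuation (FunField K b)

/-- The order of vanishing at `P` of a nonzero rational function. -/
def ord (P : Point K b) (h : FunField K b) : ℤ := -WithZero.log (P.valuation h)

lemma ord_one (P : Point K b) : ord P (1 : FunField K b) = 0 := by simp [ord]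

lemma ord_mul (P : Point K b) {g h : FunField K b} (hg : g ≠ 0) (hh : h ≠ 0) :
    ord P (g * h) = ord P g + ord P h := by
  rw [ord, ord, ord, map_mul, log_mul ((Valuation.ne_zero_iff _).2 hg)
    ((Valuation.ne_zero_iff _).2 hh)]
  ring

end Valuations

section Jacobian

variable (K : Type*) [Field K] [CharP K 5] (b : ℤ)

/-- Divisors on the curve over the algebraically closed field `K`. -/
abbrev Divisor : Type _ := Point K b →₀ ℤ

/-- The degree of a divisor: the sum of its coefficients. -/
def divDegree : Divisor K b →+ ℤ := Finsupp.liftAddHom fun _ => AddMonoidHom.id ℤ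

/-- The divisors of degree zero. -/
def degZero : AddSubgroup (Divisor K b) := (divDegree K b).ker

/-- The principal divisors: the divisors `∑ P, ord P h • P` of nonzero rational functions `h`. -/
def principal : AddSubgroup (Divisor K b) where
  carrier := {D | ∃ h : FunField K b, h ≠ 0 ∧ ∀ P, D P = ord P h}
  zero_mem' := ⟨1, one_ne_zero, fun P => by simp [ord_one]⟩
  add_mem' := by
    rintro D E ⟨g, hg, hD⟩ ⟨h, hh, hE⟩
    exact ⟨g * h, mul_ne_zero hg hh, fun P => by rw [Finsupp.add_apply, hD, hE, ord_mul P hg hh]⟩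
  neg_mem' := by
    rintro D ⟨g, hg, hD⟩
    refine ⟨g⁻¹, inv_ne_zero hg, fun P => ?_⟩
    have := ord_mul P hg (inv_ne_zero hg)
    rw [mul_inv_cancel₀ hg, ord_one] at this
    rw [Finsupp.neg_apply, hD]; omega

/-- The group of `K`-points of the Jacobian, for `K` algebraically closed: divisors of degree
zero modulo principal divisors. -/
abbrev Jac : Type _ := degZero K b ⧸ (principal K b).addSubgroupOf (degZero K b)

variable {K b}

/-- The push-forward of divisors of degree zero along a map on points. -/
def pushDegZero (g : Point K b → Point K b) : degZero K b →+ degZero K b :=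
  ((Finsupp.mapDomain.addMonoidHom g).comp (degZero K b).subtype).codRestrict (degZero K b) (by
    rintro ⟨D, hD⟩
    have h : (divDegree K b).comp (Finsupp.mapDomain.addMonoidHom g) = divDegree K b := by
      ext P; simp [divDegree]
    exact (DFunLike.congr_fun h D).trans hD)

/-- The endomorphism of the Jacobian induced by a map on points that preserves principality
of divisors. -/
def Jac.map (g : Point K b → Point K b)
    (hg : ∀ D ∈ principal K b, Finsupp.mapDomain g D ∈ principal K b) : Jac K b →+ Jac K b :=
  QuotientAddGroup.map _ _ (pushDegZero g) (fun D hD => hg D hD)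

end Jacobian


section Transport

variable {K : Type*} [Field K] {b : ℤ}

/-- The ring automorphism `u + v y ↦ τ u + c (τ v) y` of the coordinate ring. -/
def twist (τ : K[X] ≃+* K[X]) (c : K) (hc : c ≠ 0)
    (hτ : τ (quintic K b) = C c ^ 2 * quintic K b) : CoordRing K b ≃+* CoordRing K b where
  toFun r := ⟨τ r.re, C c * τ r.im⟩
  invFun r := ⟨τ.symm r.re, τ.symm (C c⁻¹ * r.im)⟩
  left_inv r := by
    refine QuadraticAlgebra.ext (by simp) ?_
    simp only [← mul_assoc, ← C_mul, inv_mul_cancel₀ hc]; simp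
  right_inv r := by
    refine QuadraticAlgebra.ext (by simp) ?_
    simp only [RingEquiv.apply_symm_apply, ← mul_assoc, ← C_mul, mul_inv_cancel₀ hc]; simp
  map_add' r s := QuadraticAlgebra.ext (by simp) (by simp; ring)
  map_mul' r s := QuadraticAlgebra.ext (by simp [hτ]; ring) (by simp; ring)

lemma norm_twist {τ : K[X] ≃+* K[X]} {c : K} (hc : c ≠ 0)
    (hτ : τ (quintic K b) = C c ^ 2 * quintic K b) (r : CoordRing K b) :
    QuadraticAlgebra.norm (twist τ c hc hτ r) = τ (QuadraticAlgebra.norm r) := by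
  rw [norm_eq, norm_eq, map_sub, map_mul, map_pow, map_pow, hτ]
  simp only [twist, RingEquiv.coe_mk, Equiv.coe_fn_mk]
  ring

variable [CharP K 5]

lemma intValuation_transport {v w : IsDedekindDomain.HeightOneSpectrum (CoordRing K b)}
    (θ : CoordRing K b ≃+* CoordRing K b) (h : ∀ r, θ r ∈ w.asIdeal ↔ r ∈ v.asIdeal)
    (r : CoordRing K b) : w.intValuation (θ r) = v.intValuation r := by
  have hmap : w.asIdeal = Ideal.map θ v.asIdeal := by
    ext s
    obtain ⟨s, rfl⟩ := θ.surjective s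
    rw [h, Ideal.mem_map_of_equiv]
    exact ⟨fun hs => ⟨s, hs, rfl⟩, fun ⟨t, ht, hts⟩ => θ.injective hts ▸ ht⟩
  have hpow (n : ℕ) : w.intValuation (θ r) ≤ exp (-(n : ℤ)) ↔ v.intValuation r ≤ exp (-(n : ℤ)) := by
    rw [w.intValuation_le_pow_iff_mem, v.intValuation_le_pow_iff_mem, hmap, ← Ideal.map_pow,
      Ideal.mem_map_of_equiv]
    exact ⟨fun ⟨t, ht, hts⟩ => θ.injective hts ▸ ht, fun hs => ⟨r, hs, rfl⟩⟩
  by_cases hr : r = 0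
  · simp [hr]
  have hr' : θ r ≠ 0 := by simpa using hr
  apply le_antisymm
  · rw [v.intValuation_if_neg hr, hpow, v.intValuation_if_neg hr]
  · rw [w.intValuation_if_neg hr', ← hpow, w.intValuation_if_neg hr']

/-- A bijection on points that is induced by an automorphism of the coordinate ring preserves
principal divisors. -/
lemma mapDomain_mem_principal {g : Point K b → Point K b} (hg : Function.Bijective g)
    (θ : CoordRing K b ≃+* CoordRing K b) (hinf : g .infinity = .infinity)
    (hdeg : ∀ r, (QuadraticAlgebra.norm (θ r)).natDegree = (QuadraticAlgebra.norm r).natDegree)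
    (haff : ∀ x y h, ∃ x' y' h', g (.affine x y h) = .affine x' y' h' ∧
      ∀ r, evalAt x' y' h' (θ r) = 0 ↔ evalAt x y h r = 0)
    (D : Divisor K b) (hD : D ∈ principal K b) : Finsupp.mapDomain g D ∈ principal K b := by
  obtain ⟨f, hf, hD⟩ := hD
  let Θ : FunField K b ≃+* FunField K b := IsFractionRing.ringEquivOfRingEquiv θ
  have hΘ (r : CoordRing K b) : Θ (algebraMap _ _ r) = algebraMap _ _ (θ r) :=
    IsFractionRing.ringEquivOfRingEquiv_algebraMap θ r
  have key (P : Point K b) (f : FunField K b) : (g P).valuation (Θ f) = P.valuation f := by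
    have hint (r : CoordRing K b) : (g P).valuation (Θ (algebraMap _ _ r)) =
        P.valuation (algebraMap _ _ r) := by
      rw [hΘ]
      cases P with
      | infinity =>
        rw [hinf]
        simp only [Point.valuation, inftyValuation_algebraMap]
        by_cases hr : r = 0
        · simp [hr]
        have hr' : θ r ≠ 0 := by simpa using hr
        rw [inftyIntValuation_of_ne_zero hr, inftyIntValuation_of_ne_zero hr', hdeg]
      | affine x y h =>
        obtain ⟨x', y', h', e, he⟩ := haff x y h
        rw [e]
        simp only [Point.valuation,
          IsDedekindDomain.HeightOneSpectrum.valuation_of_algebraMap]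
        exact intValuation_transport (v := pointIdeal x y h) (w := pointIdeal x' y' h') θ he r
    obtain ⟨r, s, hs, rfl⟩ := IsFractionRing.div_surjective (A := CoordRing K b) f
    rw [map_div₀, map_div₀, map_div₀, hint, hint]
  refine ⟨Θ f, by simpa using hf, fun Q => ?_⟩
  obtain ⟨P, rfl⟩ := hg.2 Q
  rw [Finsupp.mapDomain_apply hg.1, hD, ord, ord, key]

end Transport

section Maps

variable {K : Type*} [Field K] [CharP K 5] {b : ℤ}

lemma five_eq_zero : (5 : K) = 0 := by exact_mod_cast CharP.cast_eq_zero K 5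

lemma psi_equation {ρ : K} (hρ : ρ ^ 5 - ρ + 2 * (b : K) = 0) {x y : K}
    (h : y ^ 2 = x ^ 5 - x + (b : K)) :
    (2 * y) ^ 2 = (ρ - x) ^ 5 - (ρ - x) + (b : K) := by
  linear_combination 4 * h - hρ +
    (x ^ 5 - x + b + ρ ^ 4 * x - 2 * ρ ^ 3 * x ^ 2 + 2 * ρ ^ 2 * x ^ 3 - ρ * x ^ 4) *
      five_eq_zero (K := K)

/-- The map `(x, y) ↦ (ρ - x, 2 y)` on points. -/
def psiPoint (ρ : K) (hρ : ρ ^ 5 - ρ + 2 * (b : K) = 0) : Point K b → Point K b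
  | .infinity => .infinity
  | .affine x y h => .affine (ρ - x) (2 * y) (psi_equation hρ h)

lemma psiPoint_bijective (ρ : K) (hρ : ρ ^ 5 - ρ + 2 * (b : K) = 0) :
    Function.Bijective (psiPoint ρ hρ) := by
  have h4 (P : Point K b) :
      psiPoint ρ hρ (psiPoint ρ hρ (psiPoint ρ hρ (psiPoint ρ hρ P))) = P := by
    cases P with
    | infinity => rfl
    | affine x y h =>
      simp only [psiPoint, Point.affine.injEq]
      exact ⟨by ring, by linear_combination 3 * y * five_eq_zero (K := K)⟩
  exact ⟨fun P Q h => by rw [← h4 P, h, h4], fun P => ⟨_, h4 P⟩⟩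

lemma psiPoint_principal (ρ : K) (hρ : ρ ^ 5 - ρ + 2 * (b : K) = 0) (D : Divisor K b)
    (hD : D ∈ principal K b) : Finsupp.mapDomain (psiPoint ρ hρ) D ∈ principal K b := by
  have h5 := five_eq_zero (K := K)
  have hcomp : (C ρ - X : K[X]).comp (C ρ - X) = X := by simp
  let τ : K[X] ≃+* K[X] := (algEquivOfCompEqX (C ρ - X : K[X]) (C ρ - X) hcomp hcomp).toRingEquiv
  have hτ (p : K[X]) : τ p = p.comp (C ρ - X) := by
    rfl
  have h3 : (3 : K) ≠ 0 := by
    intro h; exact two_ne_zero_of_char (K := K) (by linear_combination h5 - h)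
  have hq : τ (quintic K b) = C 3 ^ 2 * quintic K b := by
    have h5' : (5 : K[X]) = 0 := by
      have := congrArg C h5
      rwa [map_zero] at this
    have hρ' : (C ρ : K[X]) ^ 5 - C ρ + 2 * C (b : K) = 0 := by
      have := congrArg C hρ
      rw [map_add, map_sub, map_pow, map_mul, map_zero] at this
      exact this
    rw [hτ, show (C 3 : K[X]) = 3 from rfl]
    simp only [quintic, add_comp, sub_comp, pow_comp, X_comp, C_comp]
    linear_combination hρ' + (C ρ * X ^ 4 - 2 * C ρ ^ 2 * X ^ 3 + 2 * C ρ ^ 3 * X ^ 2 -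
      C ρ ^ 4 * X + 2 * X - 2 * X ^ 5 - 2 * C (b : K)) * h5'
  refine mapDomain_mem_principal (psiPoint_bijective ρ hρ) (twist τ 3 h3 hq) rfl ?_ ?_ D hD
  · intro r
    rw [norm_twist, hτ, natDegree_comp]
    have : (C ρ - X : K[X]).natDegree = 1 := by
      rw [natDegree_sub, natDegree_X_sub_C]
    rw [this, mul_one]
  · intro x y h
    refine ⟨_, _, _, rfl, fun r => ?_⟩
    have : evalAt (ρ - x) (2 * y) (psi_equation hρ h) (twist τ 3 h3 hq r) = evalAt x y h r := by
      rw [evalAt_apply, evalAt_apply]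
      simp only [twist, RingEquiv.coe_mk, Equiv.coe_fn_mk, hτ, eval_mul, eval_comp, eval_sub,
        eval_C, eval_X, sub_sub_cancel]
      linear_combination (r.im.eval x * y) * h5
    rw [this]

/-- The endomorphism `ψ` of the Jacobian induced by `(x, y) ↦ (ρ - x, 2 y)`. -/
def psi (ρ : K) (hρ : ρ ^ 5 - ρ + 2 * (b : K) = 0) : Jac K b →+ Jac K b :=
  Jac.map (psiPoint ρ hρ) (psiPoint_principal ρ hρ)

lemma frob_expand (m : ℕ) (x : K) :
    (x ^ 5 - x + (b : K)) ^ 5 ^ m = (x ^ 5 ^ m) ^ 5 - x ^ 5 ^ m + (b : K) := by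
  have : Fact (Nat.Prime 5) := ⟨by norm_num⟩
  rw [← iterateFrobenius_def, map_add, map_sub, map_pow, map_intCast, iterateFrobenius_def]

lemma frob_equation (m : ℕ) {x y : K} (h : y ^ 2 = x ^ 5 - x + (b : K)) :
    (y ^ 5 ^ m) ^ 2 = (x ^ 5 ^ m) ^ 5 - x ^ 5 ^ m + (b : K) := by
  rw [← frob_expand, ← h]; ring

/-- The `5 ^ m`-power Frobenius map on points. -/
def frobPoint (m : ℕ) : Point K b → Point K b
  | .infinity => .infinity
  | .affine x y h => .affine (x ^ 5 ^ m) (y ^ 5 ^ m) (frob_equation m h)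

variable [IsAlgClosed K]

lemma frobPoint_bijective (m : ℕ) : Function.Bijective (frobPoint (K := K) (b := b) m) := by
  have : Fact (Nat.Prime 5) := ⟨by norm_num⟩
  have hinj : Function.Injective (fun x : K => x ^ 5 ^ m) := (iterateFrobenius K 5 m).injective
  constructor
  · intro P Q h
    cases P <;> cases Q
    · rfl
    · simp [frobPoint] at h
    · simp [frobPoint] at h
    · simp only [frobPoint, Point.affine.injEq] at h
      simp only [Point.affine.injEq]
      exact ⟨hinj h.1, hinj h.2⟩
  · intro P
    cases P with
    | infinity => exact ⟨.infinity, rfl⟩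
    | affine x y h =>
      have h5 : 0 < 5 ^ m := by positivity
      obtain ⟨x, rfl⟩ := IsAlgClosed.exists_pow_nat_eq x h5
      obtain ⟨y, rfl⟩ := IsAlgClosed.exists_pow_nat_eq y h5
      refine ⟨.affine x y (hinj ?_), rfl⟩
      change (y ^ 2) ^ 5 ^ m = (x ^ 5 - x + (b : K)) ^ 5 ^ m
      rw [frob_expand, ← h]; ring

lemma frobPoint_principal (m : ℕ) (D : Divisor K b) (hD : D ∈ principal K b) :
    Finsupp.mapDomain (frobPoint m) D ∈ principal K b := by
  have : Fact (Nat.Prime 5) := ⟨by norm_num⟩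
  let φ : K ≃+* K := iterateFrobeniusEquiv K 5 m
  have hφ (x : K) : φ x = x ^ 5 ^ m := rfl
  let τ : K[X] ≃+* K[X] := mapEquiv φ
  have hτ (p : K[X]) : τ p = p.map (φ : K →+* K) := rfl
  have hq : τ (quintic K b) = C 1 ^ 2 * quintic K b := by
    rw [hτ]; simp [quintic]
  refine mapDomain_mem_principal (frobPoint_bijective m) (twist τ 1 one_ne_zero hq) rfl ?_ ?_ D hD
  · intro r
    rw [norm_twist, hτ, natDegree_map]
  · intro x y h
    refine ⟨_, _, _, rfl, fun r => ?_⟩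
    have : evalAt (x ^ 5 ^ m) (y ^ 5 ^ m) (frob_equation m h) (twist τ 1 one_ne_zero hq r) =
        φ (evalAt x y h r) := by
      rw [evalAt_apply, evalAt_apply, map_add, map_mul, ← hφ, ← hφ]
      simp only [twist, RingEquiv.coe_mk, Equiv.coe_fn_mk, hτ, eval_mul, eval_C, one_mul]
      have e (p : K[X]) : (p.map (φ : K →+* K)).eval (φ x) = φ (p.eval x) :=
        eval_map_apply (φ : K →+* K) x
      rw [e, e]
    rw [this, map_eq_zero_iff _ φ.injective]

/-- The `5 ^ m`-power Frobenius endomorphism of the Jacobian. -/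
def frob (K : Type*) [Field K] [CharP K 5] [IsAlgClosed K] (b : ℤ) (m : ℕ) :
    Jac K b →+ Jac K b :=
  Jac.map (frobPoint m) (frobPoint_principal m)

lemma frob_comp (m n : ℕ) (D : Jac K b) : frob K b (m + n) D = frob K b m (frob K b n D) := by
  induction D using QuotientAddGroup.induction_on with
  | H D =>
    change (QuotientAddGroup.mk _ : Jac K b) = QuotientAddGroup.mk _
    congr 1
    apply Subtype.ext
    change Finsupp.mapDomain (frobPoint (m + n)) D.1 =
      Finsupp.mapDomain (frobPoint m) (Finsupp.mapDomain (frobPoint n) D.1)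
    rw [← Finsupp.mapDomain_comp]
    congr 1
    funext P
    cases P with
    | infinity => rfl
    | affine x y h =>
      simp only [frobPoint, Function.comp, Point.affine.injEq]
      exact ⟨by rw [← pow_mul, ← pow_add, add_comm], by rw [← pow_mul, ← pow_add, add_comm]⟩

lemma frob_zero (D : Jac K b) : frob K b 0 D = D := by
  induction D using QuotientAddGroup.induction_on with
  | H D =>
    change (QuotientAddGroup.mk _ : Jac K b) = QuotientAddGroup.mk _
    congr 1
    apply Subtype.ext
    change Finsupp.mapDomain (frobPoint 0) D.1 = D.1
    convert Finsupp.mapDomain_id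
    funext P
    cases P <;> simp [frobPoint]

lemma frob_iterate (m i : ℕ) (D : Jac K b) : (frob K b m)^[i] D = frob K b (m * i) D := by
  induction i with
  | zero => simp [frob_zero]
  | succ i ih => rw [Function.iterate_succ_apply', ih, ← frob_comp, Nat.mul_succ, add_comm]

end Maps

section Trace

variable (K : Type*) [Field K] [CharP K 5] [IsAlgClosed K] (b : ℤ)

/-- The group of `𝔽_{5 ^ m}`-rational points of the Jacobian (for `m > 0`): the divisor classes
over the algebraically closed field `K` that are fixed by the `5 ^ m`-power Frobenius. -/
def rationalPoints (m : ℕ) : AddSubgroup (Jac K b) where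
  carrier := {D | frob K b m D = D}
  zero_mem' := map_zero _
  add_mem' {D E} hD hE := by
    rw [Set.mem_ofPred_eq] at *
    rw [map_add, hD, hE]
  neg_mem' {D} hD := by
    rw [Set.mem_ofPred_eq] at *
    rw [map_neg, hD]

/-- The trace `D ↦ ∑_{i < n} π ^ i D` from the `𝔽_{q ^ n}`-points of the Jacobian to the
`𝔽_q`-points, where `q = 5 ^ m` and `π` is the `q`-power Frobenius. -/
def trace (m n : ℕ) : rationalPoints K b (m * n) →+ rationalPoints K b m where
  toFun D := ⟨∑ i ∈ Finset.range n, (frob K b m)^[i] D.1, by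
    change frob K b m _ = _
    rw [map_sum]
    simp only [← Function.iterate_succ_apply']
    have h := (Finset.sum_range_succ' (fun i => (frob K b m)^[i] D.1) n).symm.trans
      (Finset.sum_range_succ (fun i => (frob K b m)^[i] D.1) n)
    have hD : (frob K b m)^[n] D.1 = D.1 := (frob_iterate m n D.1).trans D.2
    rw [hD] at h
    exact add_right_cancel h⟩
  map_zero' := by
    apply Subtype.ext
    simp [iterate_map_zero]
  map_add' D E := by
    apply Subtype.ext
    simp [iterate_map_add, Finset.sum_add_distrib]

/-- The trace-zero subgroup of the group of `𝔽_{q ^ n}`-points of the Jacobian, where `q = 5 ^ m`: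
the kernel of the trace to the `𝔽_q`-points. -/
def traceZero (m n : ℕ) : AddSubgroup (rationalPoints K b (m * n)) := (trace K b m n).ker

end Trace

end QuinticCurve

end

/-!
Functions on the curve have `dx / dy = -2 y`, because the derivative of `x ^ 5 - x + b` is `-1`;
so `y` is a local parameter at every affine point, and `y - c` has divisor
`∑ a : 𝔽₅, (x₀ + a, c) - 5 ∞`. Hence the sum of the five translates by `𝔽₅` of a point is linearly
equivalent to `5 ∞`, and `∑ a : 𝔽₅, ψ_{ρ + a} = 0` on the Jacobian, where `ψ_{ρ + a}` is the
automorphism `(x, y) ↦ (ρ + a - x, 2 y)`. Since `ρ ^ 5 = ρ - 2 b`, the `q`-power Frobenius `π`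
satisfies `π ^ i ψ_ρ = ψ_{ρ - 2 b m i} π ^ i`, and `-2 b m i` runs through `𝔽₅` when `i` runs
through `0, …, 4`.
-/

noncomputable section

open Polynomial WithZero

namespace QuinticCurve

section PrimeField

variable {p : ℕ} [Fact p.Prime]

lemma sum_range_mul_natCast {M : Type*} [AddCommMonoid M] {k : ZMod p} (hk : k ≠ 0)
    (f : ZMod p → M) : ∑ i ∈ Finset.range p, f (k * i) = ∑ a, f a := by
  rw [← Equiv.sum_comp (Equiv.mulLeft₀ k hk) f]
  refine Finset.sum_nbij' (fun i => (i : ZMod p)) ZMod.val (by simp) ?_ ?_ (by simp) (by simp)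
  · exact fun a _ => Finset.mem_range.2 a.val_lt
  · exact fun i hi => ZMod.val_cast_of_lt (Finset.mem_range.1 hi)

variable {F : Type*} [Field F] [CharP F p]

lemma add_cast_pow_sub_self (t : F) (a : ZMod p) :
    (t + a.cast) ^ p - (t + a.cast) = t ^ p - t := by
  rw [add_pow_char, ← ZMod.cast_pow', ZMod.pow_card]
  ring

lemma exists_eq_add_cast {s t : F} (h : s ^ p - s = t ^ p - t) : ∃ a : ZMod p, s = t + a.cast := by
  have hfix : (s - t) ^ p = s - t := by
    rw [sub_pow_char]
    linear_combination h
  obtain ⟨n, hn⟩ := (mem_bot_iff_intCast p F).1 ((Subfield.mem_bot_iff_pow_eq_self F p).2 hfix)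
  exact ⟨n, by rw [ZMod.cast_intCast', hn]; ring⟩

end PrimeField

section Order

lemma map_eq_zero_of_mem_ker_sq {R S : Type*} [CommRing R] [CommRing S] (φ : R →+* S) (d : R →+ S)
    (hd : ∀ r s, d (r * s) = φ r * d s + φ s * d r) {r : R} (hr : r ∈ RingHom.ker φ ^ 2) :
    d r = 0 := by
  rw [sq] at hr
  refine Submodule.mul_induction_on hr (fun s hs t ht => ?_) fun s t hs ht => ?_
  · rw [hd, RingHom.mem_ker.1 hs, RingHom.mem_ker.1 ht, zero_mul, zero_mul, add_zero]
  · rw [map_add, hs, ht, add_zero]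

lemma intValuation_eq_exp_neg_one {R : Type*} [CommRing R] [IsDedekindDomain R]
    (v : IsDedekindDomain.HeightOneSpectrum R) {r : R} (hr : r ∈ v.asIdeal)
    (hr2 : r ∉ v.asIdeal ^ 2) : v.intValuation r = exp (-1) := by
  have hr0 : r ≠ 0 := fun h => hr2 (h ▸ zero_mem _)
  have hle := (v.intValuation_le_pow_iff_mem r 1).2 (by rwa [pow_one])
  have hlt := (v.intValuation_le_pow_iff_mem r 2).not.2 hr2
  rw [v.intValuation_if_neg hr0, exp_le_exp] at hle hlt
  rw [v.intValuation_if_neg hr0, exp_inj]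
  omega

variable {K : Type*} [Field K] {b : ℤ}

/-- The derivative `d/dy` along the curve at the affine point `(x, y)`, computed on
`r = u + v y` from `dx / dy = -2 y`. -/
def derivAt (x y : K) : CoordRing K b →+ K where
  toFun r := -(2 * y) * (r.re.derivative.eval x + r.im.derivative.eval x * y) + r.im.eval x
  map_zero' := by simp
  map_add' r s := by simp; ring

lemma derivAt_apply (x y : K) (r : CoordRing K b) : derivAt x y r =
    -(2 * y) * (r.re.derivative.eval x + r.im.derivative.eval x * y) + r.im.eval x := rfl

variable [CharP K 5]

lemma derivative_quintic : derivative (quintic K b) = -1 := by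
  have h5 : ((5 : ℕ) : K) = 0 := CharP.cast_eq_zero K 5
  simp only [quintic, derivative_add, derivative_sub, derivative_X_pow, derivative_X, derivative_C,
    h5, C_0, zero_mul, zero_sub, add_zero]

lemma derivAt_mul {x y : K} (h : y ^ 2 = x ^ 5 - x + (b : K)) (r s : CoordRing K b) :
    derivAt x y (r * s) = evalAt x y h r * derivAt x y s + evalAt x y h s * derivAt x y r := by
  have hquintic : (quintic K b).eval x = y ^ 2 := by rw [h]; simp [quintic]
  simp only [derivAt_apply, evalAt_apply, QuadraticAlgebra.re_mul, QuadraticAlgebra.im_mul,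
    derivative_add, derivative_mul, derivative_quintic, eval_add, eval_mul, eval_neg, eval_one,
    hquintic, zero_mul, derivative_zero, eval_zero]
  ring

lemma ord_infinity_algebraMap {r : CoordRing K b} (hr : r ≠ 0) :
    ord .infinity (algebraMap _ (FunField K b) r) = -(QuadraticAlgebra.norm r).natDegree := by
  rw [ord, Point.valuation, inftyValuation_algebraMap, inftyIntValuation_of_ne_zero hr, log_exp]

variable {x y : K} (h : y ^ 2 = x ^ 5 - x + (b : K)) {r : CoordRing K b}

lemma ord_affine_algebraMap_of_evalAt_ne_zero (hr : evalAt x y h r ≠ 0) :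
    ord (.affine x y h) (algebraMap _ (FunField K b) r) = 0 := by
  have hmem : r ∉ (pointIdeal x y h).asIdeal := hr
  rw [ord, Point.valuation, IsDedekindDomain.HeightOneSpectrum.valuation_of_algebraMap,
    IsDedekindDomain.HeightOneSpectrum.intValuation_eq_one_iff.2 hmem, log_one, neg_zero]

lemma ord_affine_algebraMap_of_derivAt_ne_zero (hr : evalAt x y h r = 0)
    (hr' : derivAt x y r ≠ 0) : ord (.affine x y h) (algebraMap _ (FunField K b) r) = 1 := by
  have hmem : r ∈ (pointIdeal x y h).asIdeal := hr
  have hmem2 : r ∉ (pointIdeal x y h).asIdeal ^ 2 := fun hsq =>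
    hr' (map_eq_zero_of_mem_ker_sq (evalAt x y h) (derivAt x y) (derivAt_mul h) hsq)
  rw [ord, Point.valuation, IsDedekindDomain.HeightOneSpectrum.valuation_of_algebraMap,
    intValuation_eq_exp_neg_one _ hmem hmem2, log_exp, neg_neg]

end Order

section YSub

variable {K : Type*} [Field K] {b : ℤ}

/-- The function `y - c` on the curve, whose zeros are the points on the line `y = c`. -/
def ySub (b : ℤ) (c : K) : CoordRing K b := ⟨-C c, 1⟩

lemma ySub_ne_zero (c : K) : ySub b c ≠ 0 := fun h =>
  one_ne_zero (congrArg QuadraticAlgebra.im h)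

lemma natDegree_norm_ySub (c : K) : (QuadraticAlgebra.norm (ySub b c)).natDegree = 5 := by
  have hdeg : (QuadraticAlgebra.norm (ySub b c)).degree = 5 := by
    rw [degree_norm]
    simp only [ySub, one_pow, mul_one, degree_quintic, neg_sq, ← C_pow]
    exact max_eq_right (degree_C_le.trans (by norm_num))
  exact natDegree_eq_of_degree_eq_some hdeg

lemma evalAt_ySub {x y : K} (h : y ^ 2 = x ^ 5 - x + (b : K)) (c : K) :
    evalAt x y h (ySub b c) = y - c := by
  rw [evalAt_apply]
  simp only [ySub, eval_neg, eval_C, eval_one]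
  ring

lemma derivAt_ySub (x y c : K) : derivAt x y (ySub b c) = 1 := by
  simp [derivAt_apply, ySub]

variable [CharP K 5]

lemma ord_infinity_ySub (c : K) :
    ord .infinity (algebraMap _ (FunField K b) (ySub b c)) = -5 := by
  rw [ord_infinity_algebraMap (ySub_ne_zero c), natDegree_norm_ySub]
  rfl

open scoped Classical in
lemma ord_affine_ySub {x y : K} (h : y ^ 2 = x ^ 5 - x + (b : K)) (c : K) :
    ord (.affine x y h) (algebraMap _ (FunField K b) (ySub b c)) = if y = c then 1 else 0 := by
  split_ifs with hc
  · refine ord_affine_algebraMap_of_derivAt_ne_zero h ?_ ?_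
    · rw [evalAt_ySub, hc, sub_self]
    · rw [derivAt_ySub]
      exact one_ne_zero
  · refine ord_affine_algebraMap_of_evalAt_ne_zero h ?_
    rw [evalAt_ySub]
    exact sub_ne_zero.2 hc

end YSub

instance fact_prime_five : Fact (Nat.Prime 5) := ⟨by norm_num⟩

section Translate

variable {K : Type*} [Field K] [CharP K 5] {b : ℤ}

/-- The translation `(x, y) ↦ (x + a, y)` by an element `a` of the prime field. -/
def translate (a : ZMod 5) : Point K b → Point K b
  | .infinity => .infinity
  | .affine x y h => .affine (x + a.cast) y (by rw [h, add_cast_pow_sub_self])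

lemma translate_affine_eq_iff {x y x' y' : K} (h : y ^ 2 = x ^ 5 - x + (b : K))
    (h' : y' ^ 2 = x' ^ 5 - x' + (b : K)) (a : ZMod 5) :
    translate a (.affine x y h) = .affine x' y' h' ↔ x + a.cast = x' ∧ y = y' := by
  rw [translate, Point.affine.injEq]

open scoped Classical in
lemma sum_single_translate_apply {x y x' y' : K} (h : y ^ 2 = x ^ 5 - x + (b : K))
    (h' : y' ^ 2 = x' ^ 5 - x' + (b : K)) :
    ∑ a : ZMod 5, Finsupp.single (translate a (.affine x y h)) (1 : ℤ) (.affine x' y' h') =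
      if y' = y then 1 else 0 := by
  simp only [Finsupp.single_apply, translate_affine_eq_iff]
  split_ifs with hy
  · subst hy
    obtain ⟨a₀, rfl⟩ : ∃ a : ZMod 5, x' = x + a.cast :=
      exists_eq_add_cast (by linear_combination h - h')
    have hcast (a : ZMod 5) : (a.cast : K) = a₀.cast ↔ a = a₀ :=
      (ZMod.castHom_injective K).eq_iff
    simp [hcast]
  · exact Finset.sum_eq_zero fun a _ => if_neg fun ha => hy ha.2.symm

lemma sum_single_translate_sub_mem_principal (P : Point K b) :
    ∑ a : ZMod 5, Finsupp.single (translate a P) (1 : ℤ) - Finsupp.single .infinity 5 ∈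
      principal K b := by
  cases P with
  | infinity => simp [translate]
  | affine x y h =>
    refine ⟨algebraMap _ (FunField K b) (ySub b y),
      (map_ne_zero_iff _ (IsFractionRing.injective _ _)).2 (ySub_ne_zero y), fun P => ?_⟩
    rw [Finsupp.sub_apply, Finsupp.finsetSum_apply]
    cases P with
    | infinity =>
      rw [ord_infinity_ySub]
      simp [translate]
    | affine x' y' h' =>
      rw [ord_affine_ySub, sum_single_translate_apply]
      simp

end Translate

section JacMap

variable {K : Type*} [Field K] [CharP K 5] {b : ℤ}

lemma Jac.map_map_comm {f g f' g' : Point K b → Point K b}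
    (hf : ∀ D ∈ principal K b, Finsupp.mapDomain f D ∈ principal K b)
    (hg : ∀ D ∈ principal K b, Finsupp.mapDomain g D ∈ principal K b)
    (hf' : ∀ D ∈ principal K b, Finsupp.mapDomain f' D ∈ principal K b)
    (hg' : ∀ D ∈ principal K b, Finsupp.mapDomain g' D ∈ principal K b)
    (hcomm : ∀ P, f (g P) = g' (f' P)) (D : Jac K b) :
    Jac.map f hf (Jac.map g hg D) = Jac.map g' hg' (Jac.map f' hf' D) := by
  induction D using QuotientAddGroup.induction_on with
  | H D =>
    refine congrArg QuotientAddGroup.mk (Subtype.ext ?_)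
    change Finsupp.mapDomain f (Finsupp.mapDomain g D.1) =
      Finsupp.mapDomain g' (Finsupp.mapDomain f' D.1)
    rw [← Finsupp.mapDomain_comp, ← Finsupp.mapDomain_comp]
    exact congrArg (Finsupp.mapDomain · D.1) (funext hcomm)

variable {ι : Type*} {s : Finset ι} {g : ι → Point K b → Point K b} {E : Divisor K b}

lemma sum_mapDomain_sub_mem_principal
    (h : ∀ P, ∑ i ∈ s, Finsupp.single (g i P) (1 : ℤ) - E ∈ principal K b) (D : Divisor K b) :
    ∑ i ∈ s, Finsupp.mapDomain (g i) D - divDegree K b D • E ∈ principal K b := by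
  induction D using Finsupp.induction_linear with
  | zero => simp
  | add D D' hD hD' =>
    convert add_mem hD hD' using 1
    simp only [Finsupp.mapDomain_add, Finset.sum_add_distrib, map_add, add_smul]
    abel
  | single P n =>
    convert zsmul_mem (h P) n using 1
    simp [Finsupp.mapDomain_single, divDegree, smul_sub, Finset.smul_sum]

lemma Jac.sum_map_eq_zero
    (hg : ∀ i, ∀ D ∈ principal K b, Finsupp.mapDomain (g i) D ∈ principal K b)
    (h : ∀ P, ∑ i ∈ s, Finsupp.single (g i P) (1 : ℤ) - E ∈ principal K b) (D : Jac K b) :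
    ∑ i ∈ s, Jac.map (g i) (hg i) D = 0 := by
  induction D using QuotientAddGroup.induction_on with
  | H D =>
    change ∑ i ∈ s, QuotientAddGroup.mk' _ (pushDegZero (g i) D) = 0
    rw [← map_sum]
    refine (QuotientAddGroup.eq_zero_iff _).2 (AddSubgroup.mem_addSubgroupOf.2 ?_)
    have hdeg : divDegree K b D.1 = 0 := D.2
    have hprincipal := sum_mapDomain_sub_mem_principal h D.1
    rw [hdeg, zero_smul, sub_zero] at hprincipal
    rwa [AddSubgroup.val_finsetSum]

end JacMap

section Psi

variable {K : Type*} [Field K] [CharP K 5] {b : ℤ} {ρ : K}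

lemma root_add_cast (hρ : ρ ^ 5 - ρ + 2 * (b : K) = 0) (a : ZMod 5) :
    (ρ + a.cast) ^ 5 - (ρ + a.cast) + 2 * (b : K) = 0 := by
  rw [add_cast_pow_sub_self, hρ]

lemma root_pow_five_pow (hρ : ρ ^ 5 - ρ + 2 * (b : K) = 0) (n : ℕ) :
    ρ ^ 5 ^ n = ρ + (-2 * b * n : ZMod 5).cast := by
  have htwo : ((2 : ZMod 5).cast : K) = 2 := map_ofNat (ZMod.castHom (dvd_refl 5) K) 2
  have hcast (j : ℕ) : ((-2 * b * j : ZMod 5).cast : K) = -2 * b * j := by simp [htwo]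
  induction n with
  | zero => simp
  | succ n ih =>
    have hpow := add_cast_pow_sub_self ρ (-2 * b * n : ZMod 5)
    rw [hcast] at hpow
    rw [pow_succ, pow_mul, ih, hcast, hcast, Nat.cast_succ]
    linear_combination hpow + hρ

lemma psiPoint_add_cast (hρ : ρ ^ 5 - ρ + 2 * (b : K) = 0) (a : ZMod 5) (P : Point K b) :
    psiPoint (ρ + a.cast) (root_add_cast hρ a) P = translate a (psiPoint ρ hρ P) := by
  cases P with
  | infinity => rfl
  | affine x y h =>
    rw [psiPoint, psiPoint, translate, Point.affine.injEq]
    exact ⟨by ring, rfl⟩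

lemma sum_psi_add_cast_eq_zero (hρ : ρ ^ 5 - ρ + 2 * (b : K) = 0) (D : Jac K b) :
    ∑ a : ZMod 5, psi (ρ + a.cast) (root_add_cast hρ a) D = 0 := by
  have hfiber (P : Point K b) :
      ∑ a : ZMod 5, Finsupp.single (psiPoint (ρ + a.cast) (root_add_cast hρ a) P) (1 : ℤ) -
        Finsupp.single .infinity 5 ∈ principal K b := by
    simp_rw [psiPoint_add_cast hρ]
    exact sum_single_translate_sub_mem_principal _
  simp only [psi]
  exact Jac.sum_map_eq_zero (fun a => psiPoint_principal _ (root_add_cast hρ a)) hfiber D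

lemma frobPoint_psiPoint (hρ : ρ ^ 5 - ρ + 2 * (b : K) = 0) (n : ℕ) (P : Point K b) :
    frobPoint n (psiPoint ρ hρ P) =
      psiPoint (ρ + (-2 * b * n : ZMod 5).cast) (root_add_cast hρ _) (frobPoint n P) := by
  cases P with
  | infinity => rfl
  | affine x y h =>
    have htwo : (2 : K) ^ 5 ^ n = 2 := by
      rw [← iterateFrobenius_def, map_ofNat]
    simp only [frobPoint, psiPoint, sub_pow_char_pow, root_pow_five_pow hρ, mul_pow, htwo]

variable [IsAlgClosed K]

lemma frob_psi (hρ : ρ ^ 5 - ρ + 2 * (b : K) = 0) (n : ℕ) (D : Jac K b) :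
    frob K b n (psi ρ hρ D) =
      psi (ρ + (-2 * b * n : ZMod 5).cast) (root_add_cast hρ _) (frob K b n D) :=
  Jac.map_map_comm _ _ _ _ (frobPoint_psiPoint hρ n) D

end Psi

section RationalPoints

variable {K : Type*} [Field K] [CharP K 5] [IsAlgClosed K] {b : ℤ} {m : ℕ}

lemma mem_rationalPoints_iff {D : Jac K b} : D ∈ rationalPoints K b m ↔ frob K b m D = D :=
  Iff.rfl

lemma mem_traceZero_iff {n : ℕ} {D : rationalPoints K b (m * n)} :
    D ∈ traceZero K b m n ↔ ∑ i ∈ Finset.range n, frob K b (m * i) D.1 = 0 := by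
  have htrace : (trace K b m n D).1 = ∑ i ∈ Finset.range n, frob K b (m * i) D.1 := by
    change ∑ i ∈ Finset.range n, (frob K b m)^[i] D.1 = _
    simp only [frob_iterate]
  rw [← htrace]
  exact AddMonoidHom.mem_ker.trans Subtype.ext_iff

lemma frob_mul_eq_self {D : Jac K b} (hD : D ∈ rationalPoints K b m) (i : ℕ) :
    frob K b (m * i) D = D := by
  rw [← frob_iterate]
  exact Function.iterate_fixed hD i

variable {ρ : K} {D : Jac K b}

lemma frob_mul_psi (hρ : ρ ^ 5 - ρ + 2 * (b : K) = 0) (hD : D ∈ rationalPoints K b m) (i : ℕ) :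
    frob K b (m * i) (psi ρ hρ D) =
      psi (ρ + (-2 * b * m * i : ZMod 5).cast) (root_add_cast hρ _) D := by
  rw [frob_psi, frob_mul_eq_self hD]
  simp only [Nat.cast_mul, mul_assoc]

lemma psi_mem_rationalPoints (hρ : ρ ^ 5 - ρ + 2 * (b : K) = 0) (hD : D ∈ rationalPoints K b m) :
    psi ρ hρ D ∈ rationalPoints K b (m * 5) := by
  rw [mem_rationalPoints_iff, frob_mul_psi hρ hD]
  simp only [CharP.cast_eq_zero, mul_zero, ZMod.cast_zero, add_zero]

lemma sum_frob_psi_eq_zero (hm : ¬ 5 ∣ m) (hb : ¬ (5 : ℤ) ∣ b)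
    (hρ : ρ ^ 5 - ρ + 2 * (b : K) = 0) (hD : D ∈ rationalPoints K b m) :
    ∑ i ∈ Finset.range 5, frob K b (m * i) (psi ρ hρ D) = 0 := by
  have hm' : (m : ZMod 5) ≠ 0 := (ZMod.natCast_eq_zero_iff m 5).not.2 hm
  have hb' : (b : ZMod 5) ≠ 0 := (ZMod.intCast_zmod_eq_zero_iff_dvd b 5).not.2 hb
  have hk : (-2 * b * m : ZMod 5) ≠ 0 := mul_ne_zero (mul_ne_zero (by decide) hb') hm'
  calc ∑ i ∈ Finset.range 5, frob K b (m * i) (psi ρ hρ D)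
      = ∑ i ∈ Finset.range 5,
          psi (ρ + (-2 * b * m * i : ZMod 5).cast) (root_add_cast hρ _) D :=
        Finset.sum_congr rfl fun i _ => frob_mul_psi hρ hD i
    _ = ∑ a : ZMod 5, psi (ρ + a.cast) (root_add_cast hρ a) D :=
        sum_range_mul_natCast hk fun a => psi (ρ + a.cast) (root_add_cast hρ a) D
    _ = 0 := sum_psi_add_cast_eq_zero hρ D

end RationalPoints

end QuinticCurve

end

theorem mainTheorem9_general {K : Type*} [Field K] [CharP K 5] [IsAlgClosed K]
    {m : ℕ} (hm : ¬ 5 ∣ m) {b : ℤ} (hb : ¬ (5 : ℤ) ∣ b)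
    {ρ : K} (hρ : ρ ^ 5 - ρ + 2 * (b : K) = 0)
    {D : QuinticCurve.Jac K b} (hD : D ∈ QuinticCurve.rationalPoints K b m) :
    ∃ h : QuinticCurve.psi ρ hρ D ∈ QuinticCurve.rationalPoints K b (m * 5),
      (⟨QuinticCurve.psi ρ hρ D, h⟩ : QuinticCurve.rationalPoints K b (m * 5)) ∈
        QuinticCurve.traceZero K b m 5 :=
  ⟨QuinticCurve.psi_mem_rationalPoints hρ hD,
    QuinticCurve.mem_traceZero_iff.2 (QuinticCurve.sum_frob_psi_eq_zero hm hb hρ hD)⟩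

theorem mainTheorem9 {K : Type*} [Field K] [CharP K 5] [IsAlgClosed K]
    (m : ℕ) (hm : Nat.Coprime m 10) (b : ℤ) (hb : b = 1 ∨ b = -1)
    (ρ : K) (hρ : ρ ^ 5 - ρ + 2 * (b : K) = 0)
    (D : QuinticCurve.Jac K b) (hD : D ∈ QuinticCurve.rationalPoints K b m) :
    ∃ h : QuinticCurve.psi ρ hρ D ∈ QuinticCurve.rationalPoints K b (m * 5),
      (⟨QuinticCurve.psi ρ hρ D, h⟩ : QuinticCurve.rationalPoints K b (m * 5)) ∈
        QuinticCurve.traceZero K b m 5 :=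
  mainTheorem9_general ((Nat.Prime.coprime_iff_not_dvd Nat.prime_five).1
    (hm.symm.coprime_dvd_left (by decide))) (by rcases hb with rfl | rfl <;> decide) hρ hD
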